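/- **Setting.** Let $\mathbb N^*=\{0,0^*,1,1^*,\dots\}$ with the order $0<0^*<1<1^*<\cdots$; write $\mathrm{succ}$ for the successor in this order. For $x,y\in\mathbb N$ put $x\oplus y=x+y$, $x^*\oplus y=x\oplus y^*=(x+y)^*$, $x^*\oplus y^*=x+y+1$, and $x\ominus y=x-y$, $x^*\ominus y=(x-y)^*$, $x^*\ominus y^*=x-y$, $x\ominus y^*=(x-y-1)^*$. A budget $B^*$ means a budget of $B$ together with the tie-breaking advantage. For $k\in\mathbb N$ let $[k]=\{0,0^*,\dots,k,k^*\}$, so $|[k]|=2(k+1)$. An energy discrete-bidding game $\mathcal G=\langle V,E,k,w\rangle$ consists of a finite directed graph $(V,E)$ in which every vertex $v$ has a non-empty set $N(v)$ of out-neighbors, a total budget $k\in\mathbb N$, and weights $w:E\to\mathbb Z$; let $W$ be the largest absolute weight. At a configuration $\langle v,B\rangle\in V\times[k]$ the token is on $v$, Preserver has budget $B$ and Consumer has budget $k^*\ominus B$. Both players simultaneously choose a legal bid and a vertex of $N(v)$; a bid $b\in\mathbb N^*$ is legal for a player with budget $C$ if $b\le C$ and, when $b\in\mathbb N^*\setminus\mathbb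 N$, the player holds the advantage. The higher bidder wins the bidding, and if the bids are equal the player without the advantage wins it. If Preserver wins with $\langle b,u\rangle$, the next configuration is $\langle u,B\ominus b\rangle$; if Consumer wins with $\langle b,u\rangle$, it is $\langle u,B\oplus b\rangle$. (Pure) strategies choose a legal action as a function of the finite sequence of configurations visited so far. For $M\in\mathbb Z$, Consumer $M$-wins a play that visits the vertices $v_0,v_1,\dots$ if $M+\sum_{j<m}w(v_j,v_{j+1})<0$ for some $m\ge 0$, and otherwise Preserver $M$-wins it. A player $M$-wins from a configuration if they have a strategy with which they $M$-win against every strategy of the opponent. An *energy threshold function* is a function $\mathrm{energy}:V\times[k]\to\mathbb N\cup\{\infty\}$ such that for every $\langle v,B\rangle$: if $\mathrm{energy}(v,B)=M\in\mathbb N$, then Preserver $M$-wins and Consumer $(M-1)$-wins from $\langle v,B\rangle$; if $\mathrm{energy}(v,B)=\infty$, then Consumer $M$-wins from $\langle v,B\rangle$ for every $M\in\mathbb N$. For $f:V\times[k]\to\mathbb N\cup\{\infty\}$ let $O(f)(v,B)$ be the minimum, over the legal bids $b$ of Preserver at $\langle v,B\rangle$, of the larger of $$\min_{u\in N(v)}\max\{f(u,B\ominus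 b)-w(v,u),0\}\quad\text{and}\quad \max_{u\in N(v)}\max\{f(u,B\oplus t)-w(v,u),0\},$$ where $t=b$ if $B\in\mathbb N^*\setminus\mathbb N$ and $b\in\mathbb N$, and $t=\mathrm{succ}(b)$ otherwise, and where the second expression is omitted if $B\oplus t>k^*$. Let $\mathrm{trim}(f)$ be $f$ with all values larger than $|V|\cdot|[k]|\cdot W$ replaced by $\infty$. Put $\mu_0\equiv 0$, $\mu_{n+1}=O(\mu_n)$, and $\tilde\mu_n=\mathrm{trim}(\mu_n)$. Also put $\alpha_0\equiv0$ and $\alpha_{i+1}=\mathrm{trim}(O(\alpha_i))$. **Theorem.** In every energy discrete-bidding game there is a function $\mu:V\times[k]\to\mathbb N\cup\{\infty\}$ such that: 1. $\tilde\mu_n=\mu$ for all sufficiently large $n$; 2. $\alpha_{i+1}=\alpha_i$ for some $i$, and whenever $\alpha_{i+1}=\alpha_i$, this function is $\mu$; 3. $\mu$ is an energy threshold function, and it is the only one; that is, the energy threshold function exists and equals $\mu$; 4. for every configuration $\langle v,B\rangle$ and every $M\in\mathbb N$, Preserver $M$-wins from $\langle v,B\rangle$ if $M\ge\mu(v,B)$,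 and Consumer $M$-wins from $\langle v,B\rangle$ if $M<\mu(v,B)$. In particular, energy bidding games are determined: from every configuration and for every initial energy $M\in\mathbb N$, one of the two players $M$-wins. -/

import Mathlib

/-! ### Concurrent games -/

/-- The two players. In an energy game, Player 1 is Preserver and Player 2 is Consumer. -/
inductive Player
  | one
  | two

/-- The arena of a concurrent game with actions `A` and states `Q`. The value of `δ` matters only
at actions that are allowed. -/
structure ConcurrentArena (A Q : Type*) where
  allowed : Q → Player → Set A
  allowed_nonempty : ∀ q i, (allowed q i).Nonempty
  δ : Q → A → A → Q

namespace ConcurrentArena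

variable {A Q : Type*}

/-- A (pure) strategy of player `i`: `σ h q` is the action taken at the current state `q` after the
states in `h` (in chronological order) have been visited before. Only allowed actions are taken. -/
def Strategy (G : ConcurrentArena A Q) (i : Player) : Type _ :=
  {σ : List Q → Q → A // ∀ h q, σ h q ∈ G.allowed q i}

/-- The past states and the current state after `n` turns. -/
def run (G : ConcurrentArena A Q) (q₀ : Q) (σ : G.Strategy .one) (τ : G.Strategy .two) :
    ℕ → List Q × Q
  | 0 => ([], q₀)
  | n + 1 =>
    let p := run G q₀ σ τ n
    (p.1 ++ [p.2], G.δ p.2 (σ.1 p.1 p.2) (τ.1 p.1 p.2))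

/-- The infinite play from `q₀` when Player 1 follows `σ` and Player 2 follows `τ`. -/
def play (G : ConcurrentArena A Q) (q₀ : Q) (σ : G.Strategy .one) (τ : G.Strategy .two)
    (n : ℕ) : Q :=
  (G.run q₀ σ τ n).2

end ConcurrentArena

/-! ### Budgets with an advantage -/

/-- The set `ℕ* = {0, 0*, 1, 1*, …}`: `⟨x, false⟩` is `x` and `⟨x, true⟩` is `x*`. -/
@[ext]
structure StarNat where
  amount : ℕ
  adv : Bool

namespace StarNat

/-- The position in the order `0 ≺ 0* ≺ 1 ≺ 1* ≺ …`. -/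
def code (B : StarNat) : ℕ := 2 * B.amount + B.adv.toNat

theorem code_injective : Function.Injective code := by
  rintro ⟨x, a⟩ ⟨y, b⟩ h
  cases a <;> cases b <;> simp [code] at h ⊢ <;> omega

instance : LinearOrder StarNat := LinearOrder.lift' code code_injective

/-- The successor in the order `0 ≺ 0* ≺ 1 ≺ 1* ≺ …`. -/
def succ : StarNat → StarNat
  | ⟨x, false⟩ => ⟨x, true⟩
  | ⟨x, true⟩ => ⟨x + 1, false⟩

/-- The operator `⊕`. -/
def oplus : StarNat → StarNat → StarNat
  | ⟨x, false⟩, ⟨y, false⟩ => ⟨x + y, false⟩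
  | ⟨x, true⟩, ⟨y, false⟩ => ⟨x + y, true⟩
  | ⟨x, false⟩, ⟨y, true⟩ => ⟨x + y, true⟩
  | ⟨x, true⟩, ⟨y, true⟩ => ⟨x + y + 1, false⟩

/-- The operator `⊖` (used only when the second argument is at most the first). -/
def ominus : StarNat → StarNat → StarNat
  | ⟨x, true⟩, ⟨y, false⟩ => ⟨x - y, true⟩
  | ⟨x, true⟩, ⟨y, true⟩ => ⟨x - y, false⟩
  | ⟨x, false⟩, ⟨y, false⟩ => ⟨x - y, false⟩
  | ⟨x, false⟩, ⟨y, true⟩ => ⟨x - y - 1, true⟩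

/-- The legal bids of a player whose budget is `B`: bids within the budget, where the advantage can
only be used by a player who holds it. -/
def legalBids (B : StarNat) : Set StarNat :=
  {b | b ≤ B ∧ (b.adv = true → B.adv = true)}

/-- The minimal bid of Player 2 that wins against a bid `b` of Player 1, whose budget is `B`. -/
def trump (B b : StarNat) : StarNat :=
  if B.adv = true ∧ b.adv = false then b else b.succ

end StarNat

/-- The set `[k] = {0, 0*, 1, 1*, …, k, k*}`. -/
def Budget (k : ℕ) : Type := {B : StarNat // B ≤ ⟨k, true⟩}

/-- An element of `ℕ*` as an element of `[k]`; the minimum has no effect on elements of `[k]`. -/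
def Budget.of (k : ℕ) (B : StarNat) : Budget k :=
  ⟨min B ⟨k, true⟩, min_le_right _ _⟩

/-! ### Energy bidding games -/

/-- An energy bidding game `⟨V, E, k, w⟩`: every vertex has a neighbor, `k` is the total budget, and
`w v u` is the weight of the edge from `v` to `u` (irrelevant if there is no such edge). -/
structure EnergyBiddingGame (V : Type*) where
  edge : V → V → Prop
  exists_edge : ∀ v, ∃ u, edge v u
  k : ℕ
  w : V → V → ℤ

namespace EnergyBiddingGame

variable {V : Type*} (G : EnergyBiddingGame V)

/-- The neighbors of a vertex. -/
def nbr (v : V) : Set V := {u | G.edge v u}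

/-- The largest absolute value of a weight of an edge. -/
noncomputable def W [Fintype V] : ℕ :=
  open Classical in
  (Finset.univ.filter fun e : V × V => G.edge e.1 e.2).sup fun e => (G.w e.1 e.2).natAbs

/-- A configuration `⟨v, B⟩`: the token is on `v`, the budget of Player 1 is `B`, and that of
Player 2 is `k* ⊖ B`. -/
abbrev Config : Type _ := V × Budget G.k

/-- An action `⟨b, u⟩`: bid `b`, and move to `u` upon winning the bidding. -/
abbrev Action : Type _ := Budget G.k × V

/-- The budget of each player at a configuration. -/
def budgetOf (c : G.Config) : Player → StarNat
  | .one => c.2.1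
  | .two => StarNat.ominus ⟨G.k, true⟩ c.2.1

/-- Player 1 wins the bidding if her bid is higher, or if the bids are equal and she does not hold
the advantage (equal legal bids mean that the player with the advantage did not use it). -/
def FirstWinsBid (c : G.Config) (b₁ b₂ : StarNat) : Prop :=
  b₂ < b₁ ∨ (b₁ = b₂ ∧ c.2.1.adv = false)

/-- The concurrent game that corresponds to the bidding game. -/
noncomputable def arena : ConcurrentArena G.Action G.Config where
  allowed c i := {a | a.1.1 ∈ (G.budgetOf c i).legalBids ∧ a.2 ∈ G.nbr c.1}
  allowed_nonempty c i := by
    obtain ⟨u, hu⟩ := G.exists_edge c.1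
    refine ⟨⟨⟨⟨0, false⟩, ?_⟩, u⟩, ⟨?_, ?_⟩, hu⟩
    · exact Nat.zero_le _
    · exact Nat.zero_le _
    · intro h
      cases h
  δ c a₁ a₂ :=
    open Classical in
    if G.FirstWinsBid c a₁.1.1 a₂.1.1 then
      (a₁.2, Budget.of G.k (c.2.1.ominus a₁.1.1))
    else
      (a₂.2, Budget.of G.k (c.2.1.oplus a₂.1.1))

/-- The path in the graph that two strategies give rise to. -/
noncomputable def path (c : G.Config) (σ : G.arena.Strategy .one) (τ : G.arena.Strategy .two)
    (n : ℕ) : V :=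
  (G.arena.play c σ τ n).1

/-- The sum of the weights traversed by the prefix of length `m` of a path. -/
def sumOfWeights (π : ℕ → V) (m : ℕ) : ℤ :=
  ∑ j ∈ Finset.range m, G.w (π j) (π (j + 1))

/-- Preserver `M`-wins a path. -/
def PresWinsPath (M : ℤ) (π : ℕ → V) : Prop := ∀ m, 0 ≤ M + G.sumOfWeights π m

/-- Consumer `M`-wins a path. -/
def ConsWinsPath (M : ℤ) (π : ℕ → V) : Prop := ∃ m, M + G.sumOfWeights π m < 0

/-- Preserver `M`-wins from a configuration. -/
def PresWins (M : ℤ) (c : G.Config) : Prop :=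
  ∃ σ : G.arena.Strategy .one, ∀ τ : G.arena.Strategy .two, G.PresWinsPath M (G.path c σ τ)

/-- Consumer `M`-wins from a configuration. -/
def ConsWins (M : ℤ) (c : G.Config) : Prop :=
  ∃ τ : G.arena.Strategy .two, ∀ σ : G.arena.Strategy .one, G.ConsWinsPath M (G.path c σ τ)

/-- `e` is an energy threshold function of the game. -/
def IsEnergyThreshold (e : V → Budget G.k → ℕ∞) : Prop :=
  ∀ v B,
    (∀ M : ℕ, e v B = M → G.PresWins M (v, B) ∧ G.ConsWins ((M : ℤ) - 1) (v, B)) ∧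
    (e v B = ⊤ → ∀ M : ℕ, G.ConsWins M (v, B))

/-- The game is determined: from every configuration and with every initial energy, one of the
players has a winning strategy. -/
def Determined : Prop :=
  ∀ (c : G.Config) (M : ℕ), G.PresWins M c ∨ G.ConsWins M c

/-! ### Value iteration -/

/-- `max {x - w, 0}`, where `∞ - w = ∞`. -/
def deduct : ℕ∞ → ℤ → ℕ∞
  | ⊤, _ => ⊤
  | (x : ℕ), w => ((max ((x : ℤ) - w) 0).toNat : ℕ)

/-- The energy needed if Preserver bids `b` and wins the bidding. -/
noncomputable def eWin (f : V → Budget G.k → ℕ∞) (v : V) (B b : StarNat) : ℕ∞ :=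
  ⨅ u ∈ G.nbr v, deduct (f u (Budget.of G.k (B.ominus b))) (G.w v u)

/-- The energy needed if Preserver bids `b` and Consumer wins by the bid `trump B b`. -/
noncomputable def eLose (f : V → Budget G.k → ℕ∞) (v : V) (B b : StarNat) : ℕ∞ :=
  ⨆ u ∈ G.nbr v, deduct (f u (Budget.of G.k (B.oplus (B.trump b)))) (G.w v u)

/-- The energy needed if Preserver bids `b`. Consumer can win the bidding only if
`B ⊕ trump B b ≤ k*`. -/
noncomputable def eNext (f : V → Budget G.k → ℕ∞) (v : V) (B b : StarNat) : ℕ∞ :=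
  if B.oplus (B.trump b) ≤ ⟨G.k, true⟩ then max (G.eWin f v B b) (G.eLose f v B b)
  else G.eWin f v B b

/-- One step of value iteration. -/
noncomputable def step (f : V → Budget G.k → ℕ∞) (v : V) (B : Budget G.k) : ℕ∞ :=
  ⨅ b ∈ B.1.legalBids, G.eNext f v B.1 b

/-- The functions `μ_n`. -/
noncomputable def mu : ℕ → V → Budget G.k → ℕ∞
  | 0 => fun _ _ => 0
  | n + 1 => G.step (mu n)

/-- Trimming: values above `|V| · |[k]| · W` are replaced by `∞`. Here `|[k]| = 2 (k + 1)`, so that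
`|V| · |[k]|` is the number of configurations. -/
noncomputable def trim [Fintype V] (f : V → Budget G.k → ℕ∞) (v : V) (B : Budget G.k) : ℕ∞ :=
  if f v B ≤ ((Fintype.card V * (2 * (G.k + 1)) * G.W : ℕ) : ℕ∞) then f v B else ⊤

/-- The trimmed functions: `μ_n` with values above the bound replaced by `∞`. -/
noncomputable def trimmedMu [Fintype V] (n : ℕ) : V → Budget G.k → ℕ∞ := G.trim (G.mu n)

/-- The iteration as an algorithm runs it: values are trimmed after every step, and the next step
starts from the trimmed function. -/
noncomputable def algMu [Fintype V] : ℕ → V → Budget G.k → ℕ∞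
  | 0 => fun _ _ => 0
  | n + 1 => G.trim (G.step (algMu n))

end EnergyBiddingGame

/-!
Let `leastEnergy` be the least fixed point of `step`. Preserver wins with every energy `E` that is
at least its value at the current configuration: `step f = f` says that some bid keeps this true if
Consumer wins by the smallest possible bid, and larger winning bids of Consumer only help Preserver
because `leastEnergy` is antitone in her budget. If `E` is less than `μ_n`, then Consumer can make
the energy less than `μ_(n-1)` at the next configuration, and hence negative within `n` turns. As
the graph is finitely branching, `step` commutes with directed suprema, so that `leastEnergy` is the
supremum of the `μ_n`, and the two cases are exhaustive.

Trimming is harmless because each positive finite value `x` of `leastEnergy` exceeds some other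
value by at most `W`: otherwise, lowering all values from `x` on by `1` would give a function `f`
with `step f ≤ f` that is not above `leastEnergy`. Hence the finite values are at most
`|V| · |[k]| · W`.

The positions in `0 ≺ 0* ≺ 1 ≺ 1* ≺ …` turn `⊕` and `⊖` into addition and subtraction of natural
numbers, and holding or using the advantage into oddness.
-/

theorem le_card_mul_of_exists_lt_le_add {ι : Type*} [Finite ι] {f : ι → ℕ∞} {w : ℕ}
    (h : ∀ i, f i ≠ 0 → f i ≠ ⊤ → ∃ j, f j < f i ∧ f i ≤ f j + w) {i : ι} (hi : f i ≠ ⊤) :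
    f i ≤ (Nat.card ι * w : ℕ) := by
  suffices f i ≤ ({j | f j < f i}.ncard * w : ℕ) from
    this.trans (Nat.cast_le.2 (Nat.mul_le_mul_right w (Set.ncard_le_card _)))
  induction hx : f i using WellFoundedLT.induction generalizing i with
  | ind x ih =>
    subst hx
    rcases eq_or_ne (f i) 0 with h0 | h0
    · simp only [h0, zero_le]
    obtain ⟨j, hlt, hle⟩ := h i h0 hi
    have hcard : {l | f l < f j}.ncard < {l | f l < f i}.ncard :=
      Set.ncard_lt_ncard ⟨fun _ hl => hl.trans hlt, fun hsub => lt_irrefl (f j) (hsub hlt)⟩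
    calc f i ≤ f j + w := hle
      _ ≤ ({l | f l < f j}.ncard * w : ℕ) + w := by
        gcongr
        exact ih _ hlt (hlt.trans_le le_top).ne rfl
      _ = (({l | f l < f j}.ncard + 1) * w : ℕ) := by push_cast; ring
      _ ≤ ({l | f l < f i}.ncard * w : ℕ) := by gcongr; exact hcard

/-! ### Strategies from one-turn guarantees -/

namespace ConcurrentArena

variable {A Q : Type*} {G : ConcurrentArena A Q} {q₀ : Q}

theorem length_run (σ : G.Strategy .one) (τ : G.Strategy .two) (n : ℕ) :
    (G.run q₀ σ τ n).1.length = n := by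
  induction n with
  | zero => rfl
  | succ n ih => simp only [run, List.length_append, List.length_singleton, ih]

/-- The total weight of the transitions along the history `h` and from its last state to `q`. It
lets a strategy, which sees only the past states, compute the current energy. -/
def historyWeight (w : Q → Q → ℤ) (h : List Q) (q : Q) : ℤ :=
  (List.zipWith w h (h.tail ++ [q])).sum

theorem historyWeight_concat (w : Q → Q → ℤ) (h : List Q) (q r : Q) :
    historyWeight w (h ++ [q]) r = historyWeight w h q + w q r := by
  cases h with
  | nil => simp [historyWeight]
  | cons a h =>
    have hlen : (a :: h).length = (h ++ [q]).length := by simp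
    simp only [historyWeight, List.cons_append, List.tail_cons]
    rw [← List.cons_append, List.zipWith_append hlen]
    simp

theorem historyWeight_run (w : Q → Q → ℤ) (σ : G.Strategy .one) (τ : G.Strategy .two) (n : ℕ) :
    historyWeight w (G.run q₀ σ τ n).1 (G.play q₀ σ τ n) =
      ∑ j ∈ Finset.range n, w (G.play q₀ σ τ j) (G.play q₀ σ τ (j + 1)) := by
  induction n with
  | zero => rfl
  | succ n ih =>
    rw [Finset.sum_range_succ, ← ih]
    exact historyWeight_concat w _ _ _

theorem exists_strategy_one_forall_run {I : List Q → Q → Prop} (h₀ : I [] q₀)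
    (hI : ∀ h q, I h q →
      ∃ a ∈ G.allowed q .one, ∀ b ∈ G.allowed q .two, I (h ++ [q]) (G.δ q a b)) :
    ∃ σ : G.Strategy .one, ∀ (τ : G.Strategy .two) (n : ℕ),
      I (G.run q₀ σ τ n).1 (G.play q₀ σ τ n) := by
  have hact : ∀ h q, ∃ a ∈ G.allowed q .one,
      I h q → ∀ b ∈ G.allowed q .two, I (h ++ [q]) (G.δ q a b) := fun h q => by
    by_cases hq : I h q
    · exact (hI h q hq).imp fun _ ⟨ha, hnext⟩ => ⟨ha, fun _ => hnext⟩
    · exact (G.allowed_nonempty q .one).imp fun _ ha => ⟨ha, fun h => absurd h hq⟩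
  choose σ hσ hnext using hact
  refine ⟨⟨σ, hσ⟩, fun τ n => ?_⟩
  induction n with
  | zero => exact h₀
  | succ n ih => exact hnext _ _ ih _ (τ.2 _ _)

theorem exists_strategy_two_forall_run {I P : List Q → Q → Prop} (h₀ : I [] q₀)
    (hI : ∀ h q, P h q → I h q →
      ∃ b ∈ G.allowed q .two, ∀ a ∈ G.allowed q .one, I (h ++ [q]) (G.δ q a b)) :
    ∃ τ : G.Strategy .two, ∀ σ : G.Strategy .one,
      (∀ n, P (G.run q₀ σ τ n).1 (G.play q₀ σ τ n)) →
        ∀ n, I (G.run q₀ σ τ n).1 (G.play q₀ σ τ n) := by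
  have hact : ∀ h q, ∃ b ∈ G.allowed q .two,
      P h q → I h q → ∀ a ∈ G.allowed q .one, I (h ++ [q]) (G.δ q a b) := fun h q => by
    by_cases hq : P h q ∧ I h q
    · exact (hI h q hq.1 hq.2).imp fun _ ⟨hb, hnext⟩ => ⟨hb, fun _ _ => hnext⟩
    · exact (G.allowed_nonempty q .two).imp fun _ hb => ⟨hb, fun hP hI => absurd ⟨hP, hI⟩ hq⟩
  choose τ hτ hnext using hact
  refine ⟨⟨τ, hτ⟩, fun σ hP n => ?_⟩
  induction n with
  | zero => exact h₀
  | succ n ih => exact hnext _ _ (hP n) ih _ (σ.2 _ _)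

theorem exists_strategy_one_forall_energy {w : Q → Q → ℤ} {I : Q → ℤ → Prop} {E : ℤ}
    (h₀ : I q₀ E)
    (hI : ∀ q F, I q F →
      ∃ a ∈ G.allowed q .one, ∀ b ∈ G.allowed q .two, I (G.δ q a b) (F + w q (G.δ q a b))) :
    ∃ σ : G.Strategy .one, ∀ (τ : G.Strategy .two) (n : ℕ),
      I (G.play q₀ σ τ n)
        (E + ∑ j ∈ Finset.range n, w (G.play q₀ σ τ j) (G.play q₀ σ τ (j + 1))) := by
  obtain ⟨σ, hσ⟩ := exists_strategy_one_forall_run (G := G) (q₀ := q₀)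
    (I := fun h q => I q (E + historyWeight w h q))
    (by simpa only [historyWeight, List.zipWith_nil_left, List.sum_nil, add_zero] using h₀)
    fun h q hq => by simpa only [historyWeight_concat, add_assoc] using hI q _ hq
  exact ⟨σ, fun τ n => historyWeight_run w σ τ n ▸ hσ τ n⟩

theorem exists_strategy_two_exists_energy_neg {w : Q → Q → ℤ} {J : ℕ → Q → ℤ → Prop} {n : ℕ}
    {E : ℤ} (h₀ : J n q₀ E) (hzero : ∀ q F, J 0 q F → F < 0)
    (hsucc : ∀ i q F, 0 ≤ F → J (i + 1) q F →
      ∃ b ∈ G.allowed q .two, ∀ a ∈ G.allowed q .one, J i (G.δ q a b) (F + w q (G.δ q a b))) :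
    ∃ τ : G.Strategy .two, ∀ σ : G.Strategy .one, ∃ m,
      E + ∑ j ∈ Finset.range m, w (G.play q₀ σ τ j) (G.play q₀ σ τ (j + 1)) < 0 := by
  obtain ⟨τ, hτ⟩ := exists_strategy_two_forall_run (G := G) (q₀ := q₀)
    (I := fun h q => ∃ i, i + h.length = n ∧ J i q (E + historyWeight w h q))
    (P := fun h q => 0 ≤ E + historyWeight w h q)
    ⟨n, rfl, by
      simpa only [historyWeight, List.zipWith_nil_left, List.sum_nil, add_zero] using h₀⟩
    (by
      rintro h q hP ⟨_ | i, hi, hJ⟩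
      · exact absurd hP (hzero q _ hJ).not_ge
      · obtain ⟨b, hb, hnext⟩ := hsucc i q _ hP hJ
        refine ⟨b, hb, fun a ha => ⟨i, ?_, ?_⟩⟩
        · rw [List.length_append, List.length_singleton]
          omega
        · simpa only [historyWeight_concat, add_assoc] using hnext a ha)
  refine ⟨τ, fun σ => ?_⟩
  by_contra! hnonneg
  obtain ⟨i, hi, -⟩ := hτ σ (fun m => (historyWeight_run w σ τ m).symm ▸ hnonneg m) (n + 1)
  rw [length_run] at hi
  omega

end ConcurrentArena

/-! ### Arithmetic of budgets -/

namespace StarNat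

theorem le_iff_code {A B : StarNat} : A ≤ B ↔ A.code ≤ B.code := Iff.rfl

theorem lt_iff_code {A B : StarNat} : A < B ↔ A.code < B.code := by
  simp only [lt_iff_le_not_ge, le_iff_code]

theorem adv_eq_true_iff {B : StarNat} : B.adv = true ↔ B.code % 2 = 1 := by
  obtain ⟨x, _ | _⟩ := B <;> simp [code]

theorem code_oplus (A B : StarNat) : (A.oplus B).code = A.code + B.code := by
  obtain ⟨x, _ | _⟩ := A <;> obtain ⟨y, _ | _⟩ := B <;> simp [oplus, code] <;> omega

theorem oplus_mono (A : StarNat) : Monotone A.oplus := fun B C h => by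
  simpa only [le_iff_code, code_oplus, add_le_add_iff_left] using h

theorem code_ominus {A B : StarNat} (h : B ≤ A) : (A.ominus B).code = A.code - B.code := by
  rw [le_iff_code] at h
  obtain ⟨x, _ | _⟩ := A <;> obtain ⟨y, _ | _⟩ := B <;> simp [ominus, code] at h ⊢ <;> omega

theorem oplus_zero (B : StarNat) : B.oplus ⟨0, false⟩ = B := by
  obtain ⟨x, _ | _⟩ := B <;> rfl

theorem ominus_zero (B : StarNat) : B.ominus ⟨0, false⟩ = B := by
  obtain ⟨x, _ | _⟩ := B <;> rfl

theorem code_succ (A : StarNat) : A.succ.code = A.code + 1 := by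
  obtain ⟨x, _ | _⟩ := A <;> simp [succ, code]
  omega

theorem code_star (k : ℕ) : (⟨k, true⟩ : StarNat).code = 2 * k + 1 := rfl

theorem code_trump (B b : StarNat) :
    (B.trump b).code = if B.code % 2 = 1 ∧ b.code % 2 = 0 then b.code else b.code + 1 := by
  have h : b.adv = false ↔ b.code % 2 = 0 := by
    rw [← Bool.not_eq_true, adv_eq_true_iff, Nat.mod_two_not_eq_one]
  simp only [trump, adv_eq_true_iff, h, apply_ite code, code_succ]

theorem mem_legalBids {B b : StarNat} :
    b ∈ B.legalBids ↔ b.code ≤ B.code ∧ (b.code % 2 = 1 → B.code % 2 = 1) := by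
  rw [← adv_eq_true_iff, ← adv_eq_true_iff]
  rfl

theorem zero_mem_legalBids (B : StarNat) : ⟨0, false⟩ ∈ B.legalBids :=
  ⟨Nat.zero_le _, nofun⟩

theorem finite_legalBids (B : StarNat) : B.legalBids.Finite :=
  ((Set.finite_Iic B.code).preimage code_injective.injOn).subset fun _ hb => hb.1

theorem exists_legalBid_of_le {B C b : StarNat} (h : B ≤ C) (hb : b ∈ B.legalBids) :
    ∃ c ∈ C.legalBids,
      B.ominus b ≤ C.ominus c ∧ B.oplus (B.trump b) ≤ C.oplus (C.trump c) := by
  suffices hc : ∃ c ∈ C.legalBids,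
      B.code - b.code ≤ C.code - c.code ∧
        B.code + (B.trump b).code ≤ C.code + (C.trump c).code by
    obtain ⟨c, hc, hle⟩ := hc
    refine ⟨c, hc, ?_⟩
    simpa only [le_iff_code, code_oplus, code_ominus hb.1, code_ominus hc.1] using hle
  simp only [mem_legalBids, le_iff_code, code_trump] at h hb ⊢
  -- Without the advantage, the bid `x` forces the same winning bid as `x*` does with it.
  by_cases hadv : b.code % 2 = 1 ∧ C.code % 2 = 0
  · have hcode : (⟨b.amount, false⟩ : StarNat).code = b.code - 1 := by
      obtain ⟨x, _ | _⟩ := b <;> simp [code] at hadv ⊢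
    refine ⟨⟨b.amount, false⟩, ?_⟩
    rw [hcode]
    split_ifs <;> omega
  · refine ⟨b, ?_⟩
    split_ifs <;> omega

theorem trump_mono (B : StarNat) : Monotone B.trump := fun b c h => by
  simp only [le_iff_code, code_trump] at h ⊢
  split_ifs <;> omega

theorem trump_mem_legalBids {B b : StarNat} {k : ℕ} (hB : B ≤ ⟨k, true⟩) (hb : b ∈ B.legalBids)
    (h : B.oplus (B.trump b) ≤ ⟨k, true⟩) :
    B.trump b ∈ (ominus ⟨k, true⟩ B).legalBids := by
  rw [mem_legalBids] at hb ⊢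
  rw [le_iff_code] at h
  rw [code_ominus hB]
  simp only [code_oplus, code_star, code_trump] at h ⊢
  rw [le_iff_code, code_star] at hB
  split_ifs at h ⊢ <;> omega

end StarNat

namespace Budget

instance {k : ℕ} : LinearOrder (Budget k) :=
  inferInstanceAs (LinearOrder {B : StarNat // B ≤ ⟨k, true⟩})

theorem of_mono (k : ℕ) : Monotone (of k) := fun _ _ h => min_le_min_right _ h

/-- The position of a budget in `0 ≺ 0* ≺ ⋯ ≺ k ≺ k*`, used to count `[k]`. -/
def toFin {k : ℕ} (B : Budget k) : Fin (2 * (k + 1)) := ⟨B.1.code, Nat.lt_succ_of_le B.2⟩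

theorem toFin_injective (k : ℕ) : Function.Injective (toFin (k := k)) := fun _ _ h =>
  Subtype.ext (StarNat.code_injective (Fin.ext_iff.1 h))

instance {k : ℕ} : Finite (Budget k) := Finite.of_injective _ (toFin_injective k)

theorem card_le (k : ℕ) : Nat.card (Budget k) ≤ 2 * (k + 1) := by
  simpa only [Nat.card_eq_fintype_card, Fintype.card_fin] using
    Nat.card_le_card_of_injective _ (toFin_injective k)

end Budget

namespace EnergyBiddingGame

/-- The energy `E`, which may be negative, is at least the requirement `x`. A negative energy covers
no requirement, not even `0`. -/
def Covers (E : ℤ) (x : ℕ∞) : Prop := 0 ≤ E ∧ x ≤ E.toNat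

section Covers

variable {E w : ℤ} {x y : ℕ∞}

theorem Covers.mono {F : ℤ} (h : Covers E x) (hE : E ≤ F) (hx : y ≤ x) : Covers F y :=
  ⟨h.1.trans hE, hx.trans <| h.2.trans <| Nat.cast_le.2 <| Int.toNat_le_toNat hE⟩

theorem covers_natCast_left {M : ℕ} : Covers M x ↔ x ≤ M := by
  simp only [Covers, Int.natCast_nonneg, Int.toNat_natCast, true_and]

theorem covers_natCast_right {n : ℕ} : Covers E n ↔ (n : ℤ) ≤ E := by
  rw [Covers, Nat.cast_le]
  omega

theorem not_covers_top : ¬ Covers E ⊤ := fun h => ENat.natCast_ne_top _ (top_le_iff.1 h.2)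

theorem le_of_forall_covers (h : ∀ E, Covers E y → Covers E x) : x ≤ y := by
  induction y using ENat.recTopCoe with
  | top => exact le_top
  | coe n => exact covers_natCast_left.1 (h n (covers_natCast_left.2 le_rfl))

theorem covers_sup : Covers E (x ⊔ y) ↔ Covers E x ∧ Covers E y := by
  simp only [Covers, sup_le_iff]
  tauto

theorem covers_biInf {ι : Type*} {s : Set ι} {g : ι → ℕ∞} :
    Covers E (⨅ i ∈ s, g i) ↔ ∃ i ∈ s, Covers E (g i) := by
  refine ⟨fun ⟨hE, h⟩ => ?_, fun ⟨i, hi, h⟩ => h.mono le_rfl (biInf_le g hi)⟩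
  by_contra! hlt
  have hsucc : (E.toNat : ℕ∞) + 1 ≤ ⨅ i ∈ s, g i := le_iInf₂ fun i hi =>
    Order.add_one_le_of_lt <| not_le.1 fun hle => hlt i hi ⟨hE, hle⟩
  exact (ENat.add_one_le_iff (ENat.natCast_ne_top _)).1 (hsucc.trans h) |>.false

theorem covers_iSup {ι : Type*} [Nonempty ι] {g : ι → ℕ∞} :
    Covers E (⨆ i, g i) ↔ ∀ i, Covers E (g i) := by
  simp only [Covers, iSup_le_iff, forall_and, forall_const]

theorem covers_biSup {ι : Type*} {s : Set ι} {g : ι → ℕ∞} (hE : 0 ≤ E) :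
    Covers E (⨆ i ∈ s, g i) ↔ ∀ i ∈ s, Covers E (g i) := by
  simp only [Covers, hE, iSup_le_iff, true_and]

theorem covers_deduct : Covers E (deduct x w) ↔ 0 ≤ E ∧ Covers (E + w) x := by
  induction x using ENat.recTopCoe with
  | top => exact iff_of_false not_covers_top fun h => not_covers_top h.2
  | coe n =>
    change Covers E ((max ((n : ℤ) - w) 0).toNat : ℕ) ↔ _
    rw [covers_natCast_right, covers_natCast_right]
    omega

theorem forall_covers_iff_eq :
    ((∀ M : ℕ, x = M → Covers M y ∧ ¬ Covers ((M : ℤ) - 1) y) ∧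
      (x = ⊤ → ∀ M : ℕ, ¬ Covers M y)) ↔ x = y := by
  cases x using ENat.recTopCoe with
  | top =>
    simp only [ENat.top_ne_natCast, IsEmpty.forall_iff, implies_true, true_and, forall_const,
      covers_natCast_left, not_le]
    rw [@eq_comm _ ⊤ y, ENat.eq_top_iff_forall_gt]
  | coe n =>
    simp only [Nat.cast_inj, forall_eq', ENat.natCast_ne_top, IsEmpty.forall_iff, and_true]
    cases y using ENat.recTopCoe with
    | top => exact iff_of_false (fun h => not_covers_top h.1) (ENat.natCast_ne_top n)
    | coe m =>
      rw [covers_natCast_right, covers_natCast_right, Nat.cast_inj]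
      omega

theorem deduct_mono (w : ℤ) : Monotone fun x => deduct x w := fun _ _ h =>
  le_of_forall_covers fun _ hE => covers_deduct.2 <|
    (covers_deduct.1 hE).imp_right fun hF => hF.mono le_rfl h

theorem deduct_iSup {ι : Type*} [Nonempty ι] (g : ι → ℕ∞) (w : ℤ) :
    deduct (⨆ i, g i) w = ⨆ i, deduct (g i) w := by
  refine le_antisymm (le_of_forall_covers fun E hE => ?_) (deduct_mono w).le_map_iSup
  simpa only [covers_iSup, covers_deduct, forall_and, forall_const] using hE

end Covers

variable {V : Type*} {G : EnergyBiddingGame V}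

/-! ### The step operator -/

section Step

variable {f g : V → Budget G.k → ℕ∞} {v : V} {B b : StarNat} {E F : ℤ}

theorem covers_eWin (hE : 0 ≤ E) :
    Covers E (G.eWin f v B b) ↔
      ∃ u ∈ G.nbr v, Covers (E + G.w v u) (f u (Budget.of G.k (B.ominus b))) := by
  simp only [eWin, covers_biInf, covers_deduct, hE, true_and]

theorem covers_eLose (hE : 0 ≤ E) :
    Covers E (G.eLose f v B b) ↔
      ∀ u ∈ G.nbr v, Covers (E + G.w v u) (f u (Budget.of G.k (B.oplus (B.trump b)))) := by
  simp only [eLose, covers_biSup hE, covers_deduct, hE, true_and]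

theorem covers_eNext (hE : 0 ≤ E) :
    Covers E (G.eNext f v B b) ↔
      (∃ u ∈ G.nbr v, Covers (E + G.w v u) (f u (Budget.of G.k (B.ominus b)))) ∧
        (B.oplus (B.trump b) ≤ ⟨G.k, true⟩ →
          ∀ u ∈ G.nbr v, Covers (E + G.w v u) (f u (Budget.of G.k (B.oplus (B.trump b))))) := by
  rw [← covers_eWin hE, ← covers_eLose hE, eNext]
  split_ifs with h <;> simp only [covers_sup, h, forall_const, IsEmpty.forall_iff, and_true]

theorem covers_step {B : Budget G.k} :
    Covers E (G.step f v B) ↔ ∃ b ∈ B.1.legalBids, Covers E (G.eNext f v B.1 b) := by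
  simp only [step, covers_biInf]

theorem Covers.eNext_imp (h : Covers E (G.eNext f v B b)) (hF : 0 ≤ F)
    (hfg : ∀ u ∈ G.nbr v, ∀ C, Covers (E + G.w v u) (f u C) → Covers (F + G.w v u) (g u C)) :
    Covers F (G.eNext g v B b) := by
  obtain ⟨⟨u, hu, hwin⟩, hlose⟩ := (covers_eNext h.1).1 h
  exact (covers_eNext hF).2
    ⟨⟨u, hu, hfg u hu _ hwin⟩, fun ht u hu => hfg u hu _ (hlose ht u hu)⟩

theorem Covers.step_imp {B : Budget G.k} (h : Covers E (G.step f v B)) (hF : 0 ≤ F)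
    (hfg : ∀ u ∈ G.nbr v, ∀ C, Covers (E + G.w v u) (f u C) → Covers (F + G.w v u) (g u C)) :
    Covers F (G.step g v B) := by
  obtain ⟨b, hb, hnext⟩ := covers_step.1 h
  exact covers_step.2 ⟨b, hb, hnext.eNext_imp hF hfg⟩

theorem eNext_mono (G : EnergyBiddingGame V) : Monotone G.eNext := fun _ _ hfg _ _ _ =>
  le_of_forall_covers fun _ hE =>
    hE.eNext_imp hE.1 fun u _ C hC => hC.mono le_rfl (hfg u C)

theorem step_mono (G : EnergyBiddingGame V) : Monotone G.step := fun _ _ hfg v B =>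
  iInf₂_mono fun b _ => G.eNext_mono hfg v B.1 b

theorem antitone_step (hf : ∀ v, Antitone (f v)) (v : V) : Antitone (G.step f v) := by
  intro B C hBC
  refine le_of_forall_covers fun E h => ?_
  obtain ⟨b, hb, hnext⟩ := covers_step.1 h
  obtain ⟨⟨u, hu, hwin⟩, hlose⟩ := (covers_eNext h.1).1 hnext
  obtain ⟨c, hc, hminus, hplus⟩ := StarNat.exists_legalBid_of_le hBC hb
  exact covers_step.2 ⟨c, hc, (covers_eNext h.1).2
    ⟨⟨u, hu, hwin.mono le_rfl (hf u (Budget.of_mono _ hminus))⟩, fun ht u hu =>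
      (hlose (hplus.trans ht) u hu).mono le_rfl (hf u (Budget.of_mono _ hplus))⟩⟩

theorem eLose_iSup {ι : Type*} [Nonempty ι] (S : ι → V → Budget G.k → ℕ∞) (v : V)
    (B b : StarNat) : G.eLose (⨆ i, S i) v B b = ⨆ i, G.eLose (S i) v B b := by
  simp only [eLose, iSup_apply, deduct_iSup, iSup_subtype']
  exact iSup_comm

variable {ι : Type*} [Preorder ι] [IsDirectedOrder ι] [Nonempty ι] {S : ι → V → Budget G.k → ℕ∞}

theorem eWin_iSup [Finite (G.nbr v)] (hS : Monotone S) (B b : StarNat) :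
    G.eWin (⨆ i, S i) v B b = ⨆ i, G.eWin (S i) v B b := by
  simp only [eWin, iSup_apply, deduct_iSup]
  exact ((G.nbr v).toFinite.iSup_biInf_of_monotone
    fun u _ _ _ hij => deduct_mono (G.w v u) (hS hij u _)).symm

theorem eNext_iSup [Finite (G.nbr v)] (hS : Monotone S) (B b : StarNat) :
    G.eNext (⨆ i, S i) v B b = ⨆ i, G.eNext (S i) v B b := by
  unfold eNext
  split_ifs
  · exact (congrArg₂ _ (eWin_iSup hS B b) (eLose_iSup S v B b)).trans iSup_sup_eq.symm
  · exact eWin_iSup hS B b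

theorem step_iSup [∀ v, Finite (G.nbr v)] (hS : Monotone S) :
    G.step (⨆ i, S i) = ⨆ i, G.step (S i) := by
  ext1 v
  ext1 B
  simp only [step, iSup_apply, eNext_iSup hS]
  exact (B.1.finite_legalBids.iSup_biInf_of_monotone
    fun b _ _ _ hij => G.eNext_mono (hS hij) v B.1 b).symm

end Step

/-! ### One turn of the game -/

section Turn

variable {f : V → Budget G.k → ℕ∞} {c : G.Config} {E : ℤ}

theorem firstWinsBid_iff_lt_trump {b₁ b₂ : StarNat} (h₁ : b₁ ∈ (G.budgetOf c .one).legalBids)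
    (h₂ : b₂ ∈ (G.budgetOf c .two).legalBids) :
    G.FirstWinsBid c b₁ b₂ ↔ b₂ < c.2.1.trump b₁ := by
  have hcode : b₁ = b₂ ↔ b₁.code = b₂.code := StarNat.code_injective.eq_iff.symm
  simp only [budgetOf, StarNat.mem_legalBids, StarNat.code_ominus c.2.2, StarNat.code_star]
    at h₁ h₂
  simp only [FirstWinsBid, hcode, ← Bool.not_eq_true, StarNat.adv_eq_true_iff,
    StarNat.lt_iff_code, StarNat.code_trump]
  split_ifs <;> omega

theorem arena_δ_of_lt_trump {a₁ a₂ : G.Action} (h₁ : a₁ ∈ G.arena.allowed c .one)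
    (h₂ : a₂ ∈ G.arena.allowed c .two) (h : a₂.1.1 < c.2.1.trump a₁.1.1) :
    G.arena.δ c a₁ a₂ = (a₁.2, Budget.of G.k (c.2.1.ominus a₁.1.1)) :=
  if_pos ((firstWinsBid_iff_lt_trump h₁.1 h₂.1).2 h)

theorem arena_δ_of_trump_le {a₁ a₂ : G.Action} (h₁ : a₁ ∈ G.arena.allowed c .one)
    (h₂ : a₂ ∈ G.arena.allowed c .two) (h : c.2.1.trump a₁.1.1 ≤ a₂.1.1) :
    G.arena.δ c a₁ a₂ = (a₂.2, Budget.of G.k (c.2.1.oplus a₂.1.1)) :=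
  if_neg fun hwin => h.not_gt ((firstWinsBid_iff_lt_trump h₁.1 h₂.1).1 hwin)

theorem oplus_le_of_mem_legalBids {t : StarNat} (ht : t ∈ (G.budgetOf c .two).legalBids) :
    c.2.1.oplus t ≤ ⟨G.k, true⟩ := by
  have hle := ht.1
  have hc := c.2.2
  rw [budgetOf, StarNat.le_iff_code, StarNat.code_ominus hc] at hle
  rw [StarNat.le_iff_code] at hc ⊢
  rw [StarNat.code_oplus]
  omega

theorem exists_action_one_of_covers_step (hf : ∀ v, Antitone (f v))
    (h : Covers E (G.step f c.1 c.2)) :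
    ∃ a₁ ∈ G.arena.allowed c .one, ∀ a₂ ∈ G.arena.allowed c .two,
      Covers (E + G.w c.1 (G.arena.δ c a₁ a₂).1)
        (f (G.arena.δ c a₁ a₂).1 (G.arena.δ c a₁ a₂).2) := by
  obtain ⟨b, hb, hnext⟩ := covers_step.1 h
  obtain ⟨⟨u, hu, hwin⟩, hlose⟩ := (covers_eNext h.1).1 hnext
  have ha₁ : (⟨⟨b, hb.1.trans c.2.2⟩, u⟩ : G.Action) ∈ G.arena.allowed c .one := ⟨hb, hu⟩
  refine ⟨_, ha₁, fun a₂ ha₂ => ?_⟩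
  rcases lt_or_ge a₂.1.1 (c.2.1.trump b) with hlt | hge
  · rw [arena_δ_of_lt_trump ha₁ ha₂ hlt]
    exact hwin
  · rw [arena_δ_of_trump_le ha₁ ha₂ hge]
    have hplus := c.2.1.oplus_mono hge
    exact (hlose (hplus.trans (oplus_le_of_mem_legalBids ha₂.1)) a₂.2 ha₂.2).mono le_rfl
      (hf _ (Budget.of_mono _ hplus))

theorem exists_bid_two_of_not_covers_step (hE : 0 ≤ E) (h : ¬ Covers E (G.step f c.1 c.2)) :
    ∃ t ∈ (G.budgetOf c .two).legalBids,
      (∃ u ∈ G.nbr c.1, ¬ Covers (E + G.w c.1 u) (f u (Budget.of G.k (c.2.1.oplus t)))) ∧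
        ∀ b ∈ c.2.1.legalBids, t < c.2.1.trump b → ¬ Covers E (G.eWin f c.1 c.2.1 b) := by
  -- Consumer just beats the highest bid whose success Preserver can afford, if there is one.
  rcases {b ∈ c.2.1.legalBids | Covers E (G.eWin f c.1 c.2.1 b)}.eq_empty_or_nonempty
    with hempty | hne
  · have hwin : ∀ b ∈ c.2.1.legalBids, ¬ Covers E (G.eWin f c.1 c.2.1 b) := fun b hb hcov =>
      hempty.subset ⟨hb, hcov⟩
    have hzero := hwin _ (StarNat.zero_mem_legalBids _)
    simp only [covers_eWin hE, not_exists, not_and, StarNat.ominus_zero] at hzero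
    obtain ⟨u, hu⟩ := G.exists_edge c.1
    exact ⟨_, StarNat.zero_mem_legalBids _,
      ⟨u, hu, by simpa only [StarNat.oplus_zero] using hzero u hu⟩, fun b hb _ => hwin b hb⟩
  · obtain ⟨b, ⟨hb, hcov⟩, hmax⟩ :=
      (c.2.1.finite_legalBids.subset (Set.sep_subset _ _)).exists_maximal hne
    have hnext : ¬ Covers E (G.eNext f c.1 c.2.1 b) := fun hnext =>
      h (covers_step.2 ⟨b, hb, hnext⟩)
    rw [covers_eNext hE, ← covers_eWin hE] at hnext
    push Not at hnext
    obtain ⟨ht, u, hu, hlose⟩ := hnext hcov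
    exact ⟨_, StarNat.trump_mem_legalBids c.2.2 hb ht, ⟨u, hu, hlose⟩, fun b' hb' hlt hcov' =>
      have hbb' := (StarNat.trump_mono c.2.1).reflect_lt hlt
      (hmax ⟨hb', hcov'⟩ hbb'.le).not_gt hbb'⟩

theorem exists_action_two_of_not_covers_step (hE : 0 ≤ E) (h : ¬ Covers E (G.step f c.1 c.2)) :
    ∃ a₂ ∈ G.arena.allowed c .two, ∀ a₁ ∈ G.arena.allowed c .one,
      ¬ Covers (E + G.w c.1 (G.arena.δ c a₁ a₂).1)
        (f (G.arena.δ c a₁ a₂).1 (G.arena.δ c a₁ a₂).2) := by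
  obtain ⟨t, ht, ⟨u, hu, hlose⟩, hwin⟩ := exists_bid_two_of_not_covers_step hE h
  have htk : t ≤ ⟨G.k, true⟩ := by
    have hle := oplus_le_of_mem_legalBids ht
    rw [StarNat.le_iff_code, StarNat.code_oplus] at hle
    exact (Nat.le_add_left _ _).trans hle
  have ha₂ : (⟨⟨t, htk⟩, u⟩ : G.Action) ∈ G.arena.allowed c .two := ⟨ht, hu⟩
  refine ⟨_, ha₂, fun a₁ ha₁ => ?_⟩
  rcases lt_or_ge t (c.2.1.trump a₁.1.1) with hlt | hge
  · rw [arena_δ_of_lt_trump ha₁ ha₂ hlt]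
    exact fun hcov => hwin _ ha₁.1 hlt ((covers_eWin hE).2 ⟨_, ha₁.2, hcov⟩)
  · rw [arena_δ_of_trump_le ha₁ ha₂ hge]
    exact hlose

end Turn

/-! ### The least fixed point -/

section LeastEnergy

variable (G)

/-- The step operator as a monotone map. -/
noncomputable def stepHom : (V → Budget G.k → ℕ∞) →o (V → Budget G.k → ℕ∞) :=
  ⟨G.step, G.step_mono⟩

/-- The least fixed point of the step operator: the least energy with which Preserver wins. -/
noncomputable def leastEnergy : V → Budget G.k → ℕ∞ :=
  OrderHom.lfp G.stepHom

theorem step_leastEnergy : G.step G.leastEnergy = G.leastEnergy :=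
  OrderHom.map_lfp G.stepHom

variable {G} in
theorem leastEnergy_le_of_step_le {f : V → Budget G.k → ℕ∞} (h : G.step f ≤ f) :
    G.leastEnergy ≤ f :=
  OrderHom.lfp_le G.stepHom h

theorem antitone_leastEnergy (v : V) : Antitone (G.leastEnergy v) := by
  refine OrderHom.lfp_induction (p := fun f => ∀ v, Antitone (f v)) G.stepHom
    (fun f hf _ => antitone_step hf) (fun s hs v B C hBC => ?_) v
  simp only [sSup_apply, iSup_apply]
  exact iSup_mono fun f => hs _ f.2 v hBC

theorem mu_monotone : Monotone G.mu := by
  refine monotone_nat_of_le_succ fun n => ?_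
  induction n with
  | zero => exact fun _ _ => zero_le
  | succ n ih => exact G.step_mono ih

theorem mu_le_leastEnergy (n : ℕ) : G.mu n ≤ G.leastEnergy := by
  induction n with
  | zero => exact fun _ _ => zero_le
  | succ n ih => exact (G.step_mono ih).trans G.step_leastEnergy.le

theorem leastEnergy_eq_iSup_mu [∀ v, Finite (G.nbr v)] : G.leastEnergy = ⨆ n, G.mu n := by
  refine le_antisymm (leastEnergy_le_of_step_le ?_) (iSup_le G.mu_le_leastEnergy)
  rw [step_iSup G.mu_monotone]
  exact iSup_le fun n => le_iSup G.mu (n + 1)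

end LeastEnergy

/-! ### Winning strategies -/

section Winning

variable {f e : V → Budget G.k → ℕ∞} {c : G.Config} {E : ℤ}

theorem presWins_of_step_le (hf : ∀ v, Antitone (f v)) (hstep : G.step f ≤ f)
    (h : Covers E (f c.1 c.2)) : G.PresWins E c := by
  obtain ⟨σ, hσ⟩ := G.arena.exists_strategy_one_forall_energy (w := fun c d => G.w c.1 d.1)
    (I := fun d F => Covers F (f d.1 d.2)) h fun d _ hd =>
      exists_action_one_of_covers_step hf (hd.mono le_rfl (hstep d.1 d.2))
  exact ⟨σ, fun τ n => (hσ τ n).1⟩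

theorem consWins_of_not_covers_mu {n : ℕ} (h : ¬ Covers E (G.mu n c.1 c.2)) : G.ConsWins E c :=
  G.arena.exists_strategy_two_exists_energy_neg (w := fun c d => G.w c.1 d.1)
    (J := fun i d F => ¬ Covers F (G.mu i d.1 d.2)) h
    (fun _ _ hF => not_le.1 fun hnonneg => hF ⟨hnonneg, zero_le⟩)
    fun _ _ _ hF => exists_action_two_of_not_covers_step hF

theorem PresWins.not_consWins (h : G.PresWins E c) : ¬ G.ConsWins E c := by
  rintro ⟨τ, hτ⟩
  obtain ⟨σ, hσ⟩ := h
  obtain ⟨m, hm⟩ := hτ σ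
  exact (hσ τ m).not_gt hm

theorem presWins_of_covers_leastEnergy (h : Covers E (G.leastEnergy c.1 c.2)) : G.PresWins E c :=
  presWins_of_step_le G.antitone_leastEnergy G.step_leastEnergy.le h

variable [∀ v, Finite (G.nbr v)]

theorem consWins_of_not_covers_leastEnergy (h : ¬ Covers E (G.leastEnergy c.1 c.2)) :
    G.ConsWins E c := by
  simp only [leastEnergy_eq_iSup_mu, iSup_apply, covers_iSup, not_forall] at h
  obtain ⟨n, hn⟩ := h
  exact consWins_of_not_covers_mu hn

theorem presWins_iff : G.PresWins E c ↔ Covers E (G.leastEnergy c.1 c.2) :=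
  ⟨fun h => not_not.1 (mt consWins_of_not_covers_leastEnergy h.not_consWins),
    presWins_of_covers_leastEnergy⟩

theorem consWins_iff : G.ConsWins E c ↔ ¬ Covers E (G.leastEnergy c.1 c.2) :=
  ⟨fun h hcov => (presWins_of_covers_leastEnergy hcov).not_consWins h,
    consWins_of_not_covers_leastEnergy⟩

theorem determined : G.Determined := fun c M => by
  rw [presWins_iff, consWins_iff]
  exact em _

theorem isEnergyThreshold_iff : G.IsEnergyThreshold e ↔ e = G.leastEnergy := by
  simp only [IsEnergyThreshold, presWins_iff, consWins_iff, forall_covers_iff_eq]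
  exact ⟨fun h => funext₂ h, fun h v B => congrFun₂ h v B⟩

end Winning

/-! ### Finite values are small -/

open Classical in
/-- The function `f` with all values that are at least `x` lowered by `1`. It witnesses that the
least fixed point has no large gaps between its values. -/
noncomputable def lowerFrom (x : ℕ∞) (f : V → Budget G.k → ℕ∞) (v : V) (B : Budget G.k) : ℕ∞ :=
  if f v B < x then f v B else deduct (f v B) 1

theorem lowerFrom_le (x : ℕ∞) (f : V → Budget G.k → ℕ∞) : lowerFrom x f ≤ f := fun v B =>
  le_of_forall_covers fun E hE => by
    unfold lowerFrom
    split_ifs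
    · exact hE
    · exact covers_deduct.2 ⟨hE.1, hE.mono (by omega) le_rfl⟩

theorem step_lowerFrom_le {w : ℕ} (hw : ∀ v, ∀ u ∈ G.nbr v, -(w : ℤ) ≤ G.w v u)
    {f : V → Budget G.k → ℕ∞} (hf : G.step f ≤ f) {x : ℕ∞} (hx : x ≠ 0)
    (hgap : ∀ v B, f v B < x → f v B + w < x) :
    G.step (lowerFrom x f) ≤ lowerFrom x f := by
  refine fun v B => le_of_forall_covers fun E hE => ?_
  by_cases hlt : f v B < x
  · rw [lowerFrom, if_pos hlt] at hE
    exact hE.mono le_rfl ((G.step_mono (lowerFrom_le x f) v B).trans (hf v B))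
  rw [lowerFrom, if_neg hlt, covers_deduct] at hE
  obtain ⟨hE, hcov⟩ := hE
  refine (hcov.mono le_rfl (hf v B)).step_imp hE fun u hu C hC => ?_
  have hxE : Covers (E + 1) x := hcov.mono le_rfl (not_lt.1 hlt)
  unfold lowerFrom
  split_ifs with hC'
  · obtain ⟨m, hm⟩ := ENat.ne_top_iff_exists.1 hC'.ne_top
    have hmw := hgap u C hC'
    rw [← hm] at hmw ⊢
    have hE' : Covers (E + 1) (m + w + 1 : ℕ) := hxE.mono le_rfl (Order.add_one_le_of_lt hmw)
    rw [covers_natCast_right] at hE' ⊢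
    have := hw v u hu
    omega
  · have hpos : Covers (E + 1 + G.w v u) (1 : ℕ) :=
      hC.mono le_rfl ((Order.one_le_iff_pos.2 (pos_of_ne_zero hx)).trans (not_lt.1 hC'))
    rw [covers_natCast_right] at hpos
    exact covers_deduct.2 ⟨by omega, add_right_comm E 1 _ ▸ hC⟩

theorem exists_leastEnergy_lt_le_add {w : ℕ} (hw : ∀ v, ∀ u ∈ G.nbr v, -(w : ℤ) ≤ G.w v u)
    {v : V} {B : Budget G.k} (h₀ : G.leastEnergy v B ≠ 0) (htop : G.leastEnergy v B ≠ ⊤) :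
    ∃ c : G.Config, G.leastEnergy c.1 c.2 < G.leastEnergy v B ∧
      G.leastEnergy v B ≤ G.leastEnergy c.1 c.2 + w := by
  by_contra! hgap
  have hle : G.leastEnergy v B ≤ deduct (G.leastEnergy v B) 1 := by
    simpa only [lowerFrom, lt_irrefl, if_false] using leastEnergy_le_of_step_le
      (step_lowerFrom_le hw G.step_leastEnergy.le h₀ fun u C => hgap (u, C)) v B
  obtain ⟨n, hn⟩ := ENat.ne_top_iff_exists.1 htop
  rw [← hn] at hle h₀
  rw [Nat.cast_ne_zero] at h₀
  have hcov : Covers ((n : ℤ) - 1) (deduct n 1) :=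
    covers_deduct.2 ⟨by omega, covers_natCast_right.2 (by omega)⟩
  have := covers_natCast_right.1 (hcov.mono le_rfl hle)
  omega

theorem natAbs_w_le_W [Fintype V] {v u : V} (h : u ∈ G.nbr v) : (G.w v u).natAbs ≤ G.W := by
  classical
  exact Finset.le_sup (f := fun e : V × V => (G.w e.1 e.2).natAbs)
    (Finset.mem_filter.2 ⟨Finset.mem_univ (v, u), h⟩)

theorem leastEnergy_le_of_ne_top [Fintype V] {v : V} {B : Budget G.k}
    (h : G.leastEnergy v B ≠ ⊤) :
    G.leastEnergy v B ≤ (Fintype.card V * (2 * (G.k + 1)) * G.W : ℕ) := by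
  have hw : ∀ v, ∀ u ∈ G.nbr v, -(G.W : ℤ) ≤ G.w v u := fun v u hu => by
    have := natAbs_w_le_W hu
    omega
  calc G.leastEnergy v B ≤ (Nat.card G.Config * G.W : ℕ) :=
        le_card_mul_of_exists_lt_le_add (f := fun c : G.Config => G.leastEnergy c.1 c.2)
          (fun _ => exists_leastEnergy_lt_le_add hw) (i := (v, B)) h
    _ ≤ (Fintype.card V * (2 * (G.k + 1)) * G.W : ℕ) := by
      rw [Nat.card_prod, Nat.card_eq_fintype_card]
      gcongr
      exact Budget.card_le G.k

/-! ### Trimming -/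

section Trim

variable [Fintype V] (G)

theorem le_trim (f : V → Budget G.k → ℕ∞) : f ≤ G.trim f := fun v B => by
  unfold trim
  split_ifs
  · exact le_rfl
  · exact le_top

theorem trim_mono : Monotone G.trim := fun f g hfg v B => by
  unfold trim
  split_ifs with hf hg hg
  · exact hfg v B
  · exact le_top
  · exact absurd ((hfg v B).trans hg) hf
  · exact le_rfl

theorem trim_leastEnergy : G.trim G.leastEnergy = G.leastEnergy := by
  ext1 v
  ext1 B
  exact ite_eq_left_iff.2 fun h => by_contra fun htop =>
    h (leastEnergy_le_of_ne_top (Ne.symm htop))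

theorem eventually_trimmedMu_apply_eq (v : V) (B : Budget G.k) :
    ∀ᶠ n in Filter.atTop, G.trimmedMu n v B = G.leastEnergy v B := by
  have hmono : Monotone fun n => G.mu n v B := fun _ _ h => G.mu_monotone h v B
  have hsup : G.leastEnergy v B = ⨆ n, G.mu n v B := by
    rw [leastEnergy_eq_iSup_mu, iSup_apply, iSup_apply]
  rcases eq_or_ne (G.leastEnergy v B) ⊤ with htop | htop
  · obtain ⟨N, hN⟩ := lt_iSup_iff.1 ((ENat.natCast_lt_top _).trans_eq (htop.symm.trans hsup))
    filter_upwards [Filter.eventually_ge_atTop N] with n hn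
    exact (if_neg (hN.trans_le (hmono hn)).not_ge).trans htop.symm
  · obtain ⟨N, hN⟩ := ENat.exists_eq_iSup_of_lt_top (hsup ▸ htop.lt_top)
    filter_upwards [Filter.eventually_ge_atTop N] with n hn
    have hn : G.mu n v B = G.leastEnergy v B :=
      (G.mu_le_leastEnergy n v B).antisymm (hsup.trans_le (hN.symm.trans_le (hmono hn)))
    rw [trimmedMu, trim, hn]
    exact congrFun₂ G.trim_leastEnergy v B

theorem eventually_trimmedMu_eq : ∀ᶠ n in Filter.atTop, G.trimmedMu n = G.leastEnergy := by
  simp only [funext_iff, Filter.eventually_all]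
  exact G.eventually_trimmedMu_apply_eq

theorem algMu_le_leastEnergy (n : ℕ) : G.algMu n ≤ G.leastEnergy := by
  induction n with
  | zero => exact fun _ _ => zero_le
  | succ n ih =>
    calc G.algMu (n + 1) ≤ G.trim (G.step G.leastEnergy) := G.trim_mono (G.step_mono ih)
      _ = G.leastEnergy := by rw [step_leastEnergy, trim_leastEnergy]

theorem mu_le_algMu (n : ℕ) : G.mu n ≤ G.algMu n := by
  induction n with
  | zero => exact le_rfl
  | succ n ih => exact (G.step_mono ih).trans (G.le_trim _)

theorem trimmedMu_succ_le_algMu_succ (n : ℕ) : G.trimmedMu (n + 1) ≤ G.algMu (n + 1) :=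
  G.trim_mono (G.step_mono (G.mu_le_algMu n))

theorem eventually_algMu_eq : ∀ᶠ n in Filter.atTop, G.algMu n = G.leastEnergy := by
  filter_upwards [G.eventually_trimmedMu_eq, Filter.eventually_ge_atTop 1] with n htrim hn
  obtain ⟨n, rfl⟩ := Nat.exists_eq_add_of_le' hn
  exact (G.algMu_le_leastEnergy _).antisymm (htrim.ge.trans (G.trimmedMu_succ_le_algMu_succ n))

variable {G} in
theorem algMu_eq_leastEnergy_of_succ_eq {n : ℕ} (h : G.algMu (n + 1) = G.algMu n) :
    G.algMu n = G.leastEnergy :=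
  (G.algMu_le_leastEnergy n).antisymm <| leastEnergy_le_of_step_le <| (G.le_trim _).trans h.le

end Trim

end EnergyBiddingGame

theorem mainTheorem1 {V : Type*} [Fintype V] (G : EnergyBiddingGame V) :
    ∃ μ : V → Budget G.k → ℕ∞,
      -- `μ` is the function at which the trimmed value iteration becomes stationary
      (∃ N, ∀ n ≥ N, G.trimmedMu n = μ) ∧
      -- the algorithmic form of the iteration terminates, and returns `μ`
      ((∃ i, G.algMu (i + 1) = G.algMu i) ∧
        ∀ i, G.algMu (i + 1) = G.algMu i → G.algMu (i + 1) = μ) ∧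
      -- the energy threshold function exists, is unique, and equals `μ`
      (∀ e : V → Budget G.k → ℕ∞, G.IsEnergyThreshold e ↔ e = μ) ∧
      -- who wins with which initial energy
      (∀ v B (M : ℕ),
        ((μ v B ≤ M → G.PresWins M (v, B)) ∧ ((M : ℕ∞) < μ v B → G.ConsWins M (v, B)))) ∧
      G.Determined := by
  obtain ⟨N, hN⟩ := Filter.eventually_atTop.1 G.eventually_algMu_eq
  refine ⟨G.leastEnergy, Filter.eventually_atTop.1 G.eventually_trimmedMu_eq,
    ⟨⟨N, (hN _ N.le_succ).trans (hN N le_rfl).symm⟩,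
      fun i hi => hi.trans (EnergyBiddingGame.algMu_eq_leastEnergy_of_succ_eq hi)⟩,
    fun _ => EnergyBiddingGame.isEnergyThreshold_iff, fun v B M => ?_,
    EnergyBiddingGame.determined⟩
  rw [EnergyBiddingGame.presWins_iff, EnergyBiddingGame.consWins_iff,
    EnergyBiddingGame.covers_natCast_left, not_le]
  exact ⟨id, id⟩
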